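/- Let $n\in\mathbb{N}$ and let $V\in C^2(\mathbb{R}^n)$ be real-valued. Write $(x,y)\in\mathbb{R}^n\times\mathbb{R}^n=\mathbb{R}^{2n}$, let $\|\cdot\|_{L^2}$ be the norm of the complex space $L^2(\mathbb{R}^{2n})$, and let $C_0^\infty(\mathbb{R}^{2n})$ be the space of smooth compactly supported complex-valued functions. For $j=1,\dots,n$ put $L_j=\partial_{y_j}+\frac{y_j}{2}$, with formal adjoint $L_j^*=-\partial_{y_j}+\frac{y_j}{2}$. With each fixed $x_0\in\mathbb{R}^n$ associate the operator \[ P_{x_0}=y\cdot\partial_x-\partial_xV(x_0)\cdot\partial_y-\Delta_y+\frac{|y|^2}{4}-\frac n2 = y\cdot\partial_x-\partial_xV(x_0)\cdot\partial_y+\sum_{j=1}^n L_j^*L_j , \] the two expressions being equal on $C_0^\infty(\mathbb{R}^{2n})$. For $c>0$ and $a\in\mathbb{R}$ let $(c-\Delta_x)^{a}$ be the Fourier multiplier in the variable $x$ with symbol $(c+|\xi|^2)^{a}$, where $\xi$ is dual to $x$ (so that $-\Delta_x$ has symbol $|\xi|^2$), and put $\tilde\Lambda_{x_0}=\bigl(1+\frac12|\partial_xV(x_0)|^2-\Delta_x\bigr)^{1/2}$.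 Then there is a constant $C$, independent of $x_0$ and $u$, such that for all $x_0\in\mathbb{R}^n$ and all $u\in C_0^\infty(\mathbb{R}^{2n})$ \[ |\partial_xV(x_0)|^{4/3}\|u\|_{L^2}^2+\|(1-\Delta_x)^{1/3}u\|_{L^2}^2\le C\bigl(\|P_{x_0}u\|_{L^2}^2+\|u\|_{L^2}^2\bigr), \] and also (this is an equivalent form of the estimate) \[ \|\tilde\Lambda_{x_0}^{2/3}u\|_{L^2}^2\le C\bigl(\|P_{x_0}u\|_{L^2}^2+\|u\|_{L^2}^2\bigr). \] -/

import Mathlib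

open MeasureTheory
open scoped ContDiff FourierTransform ENNReal NNReal Gradient Laplacian

noncomputable section

namespace FokkerPlanck

/-- The space `ℝⁿ` with its Euclidean structure. Functions on `ℝ²ⁿ` are functions of
`(x, y) : Space n × Space n`, with the product Lebesgue measure. -/
abbrev Space (n : ℕ) : Type := EuclideanSpace ℝ (Fin n)

variable {n : ℕ}

/-- The transport part `y · ∂ₓ u - ∂V(x₀) · ∂_y u`, frozen at `x₀`. -/
def frozenTransport (V : Space n → ℝ) (x₀ : Space n) (u : Space n × Space n → ℂ) :
    Space n × Space n → ℂ :=
  fun p => fderiv ℝ u p (p.2, 0) - fderiv ℝ u p (0, gradient V x₀)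

/-- The frozen operator
`P_{x₀} = y · ∂ₓ - ∂V(x₀) · ∂_y - Δ_y + |y|² / 4 - n / 2`. -/
def frozenOp (V : Space n → ℝ) (x₀ : Space n) (u : Space n × Space n → ℂ) :
    Space n × Space n → ℂ :=
  fun p => frozenTransport V x₀ u p
    - Laplacian.laplacian (fun y => u (p.1, y)) p.2
    + ((‖p.2‖ ^ 2 / 4 - (n : ℝ) / 2 : ℝ) : ℂ) * u p

/-- The partial derivative `∂_{y_j} u`. -/
def partialY (j : Fin n) (u : Space n × Space n → ℂ) : Space n × Space n → ℂ :=
  fun p => fderiv ℝ u p (0, EuclideanSpace.single j 1)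

/-- `L_j = ∂_{y_j} + y_j / 2`. -/
def annihilation (j : Fin n) (u : Space n × Space n → ℂ) : Space n × Space n → ℂ :=
  fun p => partialY j u p + ((p.2 j / 2 : ℝ) : ℂ) * u p

/-- The formal adjoint `L_j^* = -∂_{y_j} + y_j / 2`. -/
def creation (j : Fin n) (u : Space n × Space n → ℂ) : Space n × Space n → ℂ :=
  fun p => -partialY j u p + ((p.2 j / 2 : ℝ) : ℂ) * u p

/-- The Fourier multiplier `(c - Δₓ)^a` in the variable `x`, for `c > 0`. Since
`𝓕 f ξ = ∫ exp (-2πi⟨x, ξ⟩) f x dx`, its symbol is `(c + 4π²|ξ|²)^a`. -/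
def shiftedLaplacianPow (c a : ℝ) (u : Space n × Space n → ℂ) : Space n × Space n → ℂ :=
  fun p => 𝓕⁻ (fun ξ : Space n =>
    (((c + 4 * Real.pi ^ 2 * ‖ξ‖ ^ 2) ^ a : ℝ) : ℂ) * 𝓕 (fun x : Space n => u (x, p.2)) ξ) p.1

/-- The power `Λ̃_{x₀}^r` of `Λ̃_{x₀} = (1 + |∂V(x₀)|² / 2 - Δₓ)^{1/2}`. -/
def frozenLambdaPow (V : Space n → ℝ) (x₀ : Space n) (r : ℝ) (u : Space n × Space n → ℂ) :
    Space n × Space n → ℂ :=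
  shiftedLaplacianPow (1 + ‖gradient V x₀‖ ^ 2 / 2) (r / 2) u

/-- The squared norm of `L²(ℝ²ⁿ; ℂ)`, with value `∞` when the integral diverges. -/
def normSq (u : Space n × Space n → ℂ) : ℝ≥0∞ :=
  eLpNorm u 2 volume ^ 2

end FokkerPlanck

end

/-! Freezing $\partial_xV(x_0)=e$ makes the coefficients of $P$ independent of $x$, so a Fourier
transform in $x$ reduces the estimate to one in $L^2(\mathbb{R}^n_y)$ for each frequency $\xi$,
uniform in $\xi$ and $e$. On such a fiber $P=X+\sum_j L_j^*L_j$ with $X$ skew, $[L_j,L_j^*]=1$, and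
$[L_j,X]$ the number $\zeta_j=e_j/2+2\pi i\xi_j$. Hence $\sum_j|\zeta_j|^2=|e|^2/4+4\pi^2|\xi|^2$
carries both quantities to be controlled, the force and the frequency.

These algebraic facts suffice (`subelliptic_cube_bound`). The energy identity $\mathrm{Re}\langle
Pv,v\rangle=\sum_j\|L_jv\|^2$ controls $L_jv$ and $L_j^*v$. Pairing $[L_j,X]v=\zeta_jv$ with $v$
bounds $|\zeta_j|\|v\|^2$ by $\|Xv\|$ times these norms. Expanding $\|Pv\|^2$ bounds $\|Xv\|$, up to
a term again containing $|\zeta|$, which is absorbed (`sq_mul_cube_le_of_bounds`). The outcome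
$|\zeta|^2\|v\|^3\lesssim(\|Pv\|+\|v\|)^3$, raised to the power $2/3$, is the gain of $2/3$ of a
derivative.

The operators always act on `testFunctions`; only inner products pass to the fiber, through
`fiberMap`, so no operator on the fiber has to be constructed. Plancherel in $x$ integrates
`fiber_estimate` over $\xi$ (`lintegral_symbol_le`). -/

noncomputable section

namespace FokkerPlanck

open scoped ComplexConjugate LineDeriv SchwartzMap

/-! ### Abstract subelliptic estimate from commutation relations -/

section Subelliptic

variable {ι E H : Type*} [Fintype ι] [AddCommGroup E] [Module ℂ E]
  [NormedAddCommGroup H] [InnerProductSpace ℂ H]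

/-- A scalar absorption argument: the relations below force `t ≲ (q / m) ^ (3 / 2)`. -/
lemma sq_mul_cube_le_of_bounds {k t m q x s : ℝ} (hk : 0 ≤ k) (ht : 0 ≤ t) (hm : 0 ≤ m)
    (hmq : m ≤ q) (hx : 0 ≤ x) (hs : 0 ≤ s) (hsq : s ^ 2 = q * m)
    (h₁ : t * m ^ 2 ≤ 3 * k * (x * s)) (h₂ : x ^ 2 ≤ q ^ 2 + 2 * k * (t * m * s)) :
    t ^ 2 * m ^ 3 ≤ (18 * k ^ 2 + 324 * k ^ 6) * q ^ 3 := by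
  rcases hm.eq_or_lt with rfl | hm
  · have : 0 ≤ q := hmq
    simp only [ne_eq, OfNat.ofNat_ne_zero, not_false_eq_true, zero_pow, mul_zero]
    positivity
  have hq : 0 < q := hm.trans_le hmq
  have h₃ : (t * m ^ 2) ^ 2 ≤ (3 * k * (x * s)) ^ 2 := by gcongr
  have h₄ : t ^ 2 * m ^ 4 ≤ 9 * k ^ 2 * (q * m) * (q ^ 2 + 2 * k * (t * m * s)) := by
    calc t ^ 2 * m ^ 4 = (t * m ^ 2) ^ 2 := by ring
      _ ≤ (3 * k * (x * s)) ^ 2 := h₃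
      _ = 9 * k ^ 2 * s ^ 2 * x ^ 2 := by ring
      _ ≤ 9 * k ^ 2 * (q * m) * (q ^ 2 + 2 * k * (t * m * s)) := by
        rw [hsq]; gcongr
  -- In terms of $w=tms$, for which $w^2=t^2m^3q$, the bound becomes a quadratic inequality in $w$
  -- alone.
  set w := t * m * s with hw
  have hw2 : w ^ 2 = t ^ 2 * m ^ 3 * q := by
    rw [hw, mul_pow, hsq]; ring
  have h₅ : w ^ 2 ≤ 9 * k ^ 2 * q ^ 2 * (q ^ 2 + 2 * k * w) := by
    rw [hw2]
    refine le_of_mul_le_mul_left ?_ hm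
    calc m * (t ^ 2 * m ^ 3 * q) = t ^ 2 * m ^ 4 * q := by ring
      _ ≤ 9 * k ^ 2 * (q * m) * (q ^ 2 + 2 * k * w) * q := by gcongr
      _ = m * (9 * k ^ 2 * q ^ 2 * (q ^ 2 + 2 * k * w)) := by ring
  have h₆ : w ^ 2 ≤ (18 * k ^ 2 + 324 * k ^ 6) * q ^ 4 := by
    -- The square gives $36k^3q^2w\le w^2+324k^6q^4$, which absorbs the linear term of twice `h₅`.
    nlinarith [sq_nonneg (w - 18 * k ^ 3 * q ^ 2)]
  refine le_of_mul_le_mul_right ?_ hq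
  calc t ^ 2 * m ^ 3 * q = w ^ 2 := hw2.symm
    _ ≤ _ := h₆
    _ = _ := by ring

/-- The subelliptic estimate for `P = X + ∑ⱼ Lⱼ* Lⱼ`, where `X` is skew, `Lⱼ*` is the adjoint of
`Lⱼ`, `[Lⱼ, Lⱼ*] = 1` and `[Lⱼ, X]` is the scalar `ζⱼ`. All identities are tested in a pre-Hilbert
space through the map `J`. -/
theorem subelliptic_cube_bound (J : E →ₗ[ℂ] H) (X : E →ₗ[ℂ] E) (L M : ι → E →ₗ[ℂ] E)
    (ζ : ι → ℂ) (hL : ∀ j u w, inner ℂ (J (L j u)) (J w) = inner ℂ (J u) (J (M j w)))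
    (hX : ∀ u w, inner ℂ (J (X u)) (J w) = -inner ℂ (J u) (J (X w)))
    (hLX : ∀ j u, J (L j (X u)) - J (X (L j u)) = ζ j • J u)
    (hLM : ∀ j u, L j (M j u) - M j (L j u) = u) (v : E) :
    (∑ j, ‖ζ j‖ ^ 2) * ‖J v‖ ^ 3 ≤
      (18 * (Fintype.card ι : ℝ) ^ 2 + 324 * (Fintype.card ι : ℝ) ^ 6) *
        (‖J (X v + ∑ j, M j (L j v))‖ + ‖J v‖) ^ 3 := by
  set Pv := X v + ∑ j, M j (L j v) with hP
  set m := ‖J v‖ with hm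
  set q := ‖J Pv‖ + m with hq
  have hm0 : 0 ≤ m := norm_nonneg _
  have hq0 : 0 ≤ q := by positivity
  have hmq : m ≤ q := by simp [hq]
  set s := √(q * m) with hs
  have hsq : s ^ 2 = q * m := Real.sq_sqrt (by positivity)
  have hs0 : 0 ≤ s := Real.sqrt_nonneg _
  have hms : m ≤ s := Real.le_sqrt_of_sq_le (by nlinarith)
  have hML : ∀ j u w, inner ℂ (J (M j u)) (J w) = inner ℂ (J u) (J (L j w)) := fun j u w => by
    rw [← inner_conj_symm, ← hL, inner_conj_symm]
  have hX0 : ∀ u, (inner ℂ (J (X u)) (J u)).re = 0 := fun u => by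
    have h := congrArg Complex.re (hX u u)
    rw [← inner_conj_symm (J u) (J (X u)), Complex.neg_re, Complex.conj_re] at h
    linarith
  have hL_le : ∀ j, ‖J (L j v)‖ ≤ s := by
    intro j
    -- Energy identity: the skew part $X$ drops out of the real part.
    have h1 : ∑ j, ‖J (L j v)‖ ^ 2 = (inner ℂ (J Pv) (J v)).re := by
      rw [hP, map_add, inner_add_left, Complex.add_re, hX0, zero_add, map_sum, sum_inner,
        Complex.re_sum]
      refine Finset.sum_congr rfl fun j _ => ?_
      rw [hML, inner_self_eq_norm_sq_to_K]
      norm_cast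
    have h2 : (inner ℂ (J Pv) (J v)).re ≤ q * m := by
      refine (Complex.re_le_norm _).trans ((norm_inner_le_norm _ _).trans ?_)
      gcongr
      simp [hq, hm0]
    refine Real.le_sqrt_of_sq_le (le_trans ?_ h2)
    rw [← h1]
    exact Finset.single_le_sum (f := fun j => ‖J (L j v)‖ ^ 2) (fun i _ => by positivity)
      (Finset.mem_univ j)
  have hM_le : ∀ j, ‖J (M j v)‖ ≤ 2 * s := by
    intro j
    -- This is $[L_j,L_j^*]=1$ paired with $v$. Since $q$ contains $m$, also $m\le s$, and both
    -- terms are at most $s^2$.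
    have h1 : ‖J (M j v)‖ ^ 2 = ‖J (L j v)‖ ^ 2 + m ^ 2 := by
      have h := hML j v (M j v)
      rw [show L j (M j v) = v + M j (L j v) by rw [← sub_eq_iff_eq_add]; exact hLM j v,
        map_add, inner_add_right, ← hL j v (L j v), inner_self_eq_norm_sq_to_K,
        inner_self_eq_norm_sq_to_K, inner_self_eq_norm_sq_to_K] at h
      have h' : ‖J (M j v)‖ ^ 2 = ‖J v‖ ^ 2 + ‖J (L j v)‖ ^ 2 := by exact_mod_cast h
      linarith
    refine abs_le_of_sq_le_sq' ?_ (by positivity) |>.2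
    nlinarith [hL_le j, norm_nonneg (J (L j v))]
  set x := ‖J (X v)‖ with hx
  set t := √(∑ j, ‖ζ j‖ ^ 2) with ht
  have htsq : t ^ 2 = ∑ j, ‖ζ j‖ ^ 2 := Real.sq_sqrt (by positivity)
  have ht0 : 0 ≤ t := Real.sqrt_nonneg _
  have hζt : ∀ j, ‖ζ j‖ ≤ t := fun j => by
    refine Real.le_sqrt_of_sq_le ?_
    exact Finset.single_le_sum (f := fun j => ‖ζ j‖ ^ 2) (fun i _ => by positivity)
      (Finset.mem_univ j)
  have htζ : t ≤ ∑ j, ‖ζ j‖ := by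
    refine Real.sqrt_le_iff.2 ⟨by positivity, ?_⟩
    exact Finset.sum_sq_le_sq_sum_of_nonneg fun i _ => norm_nonneg _
  have h₁ : t * m ^ 2 ≤ 3 * (Fintype.card ι : ℝ) * (x * s) := by
    -- Pair the commutator with $v$ and move $L_j$ and $X$ across: what remains is $\langle
    -- Xv,L_j^*v\rangle+\langle L_jv,Xv\rangle$, whence $3=2+1$.
    have hj : ∀ j, ‖ζ j‖ * m ^ 2 ≤ 3 * (x * s) := by
      intro j
      have h := congrArg (fun z => inner ℂ z (J v)) (hLX j v)
      simp only [inner_sub_left, inner_smul_left] at h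
      rw [hL, hX (L j v), sub_neg_eq_add] at h
      have h' := congrArg norm h
      rw [norm_mul, inner_self_eq_norm_sq_to_K, RCLike.norm_conj, norm_pow, RCLike.norm_ofReal,
        abs_norm] at h'
      rw [← h']
      calc _ ≤ ‖inner ℂ (J (X v)) (J (M j v))‖ + ‖inner ℂ (J (L j v)) (J (X v))‖ :=
            norm_add_le _ _
        _ ≤ x * ‖J (M j v)‖ + ‖J (L j v)‖ * x :=
            add_le_add (norm_inner_le_norm _ _) (norm_inner_le_norm _ _)
        _ ≤ x * (2 * s) + s * x := by gcongr; exacts [hM_le j, hL_le j]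
        _ = _ := by ring
    calc t * m ^ 2 ≤ (∑ j, ‖ζ j‖) * m ^ 2 := by gcongr
      _ = ∑ j, ‖ζ j‖ * m ^ 2 := Finset.sum_mul ..
      _ ≤ ∑ _j : ι, 3 * (x * s) := Finset.sum_le_sum fun j _ => hj j
      _ = _ := by simp; ring
  have h₂ : x ^ 2 ≤ q ^ 2 + 2 * (Fintype.card ι : ℝ) * (t * m * s) := by
    have hj : ∀ j, -(t * m * s) ≤ (inner ℂ (J (X v)) (J (M j (L j v)))).re := by
      intro j
      -- The cross term equals $\langle L_jXv,L_jv\rangle$. Commuting $L_j$ past $X$ leaves $\langle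
      -- XL_jv,L_jv\rangle$, with zero real part, and a term with $\zeta_j$ of size at most $tms$.
      have h : inner ℂ (J (X v)) (J (M j (L j v))) =
          inner ℂ (J (X (L j v))) (J (L j v)) + conj (ζ j) * inner ℂ (J v) (J (L j v)) := by
        rw [← hL, ← inner_smul_left, ← inner_add_left, ← hLX]
        simp
      rw [h, Complex.add_re, hX0, zero_add]
      refine (neg_le_neg ?_).trans (neg_le_of_abs_le (Complex.abs_re_le_norm _))
      rw [norm_mul, RCLike.norm_conj, mul_assoc]
      gcongr
      · exact hζt j
      · exact (norm_inner_le_norm _ _).trans (by gcongr; exact hL_le j)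
    have hsum : -((Fintype.card ι : ℝ) * (t * m * s)) ≤
        (inner ℂ (J (X v)) (J (∑ j, M j (L j v)))).re := by
      rw [map_sum, inner_sum, Complex.re_sum]
      calc _ = ∑ _j : ι, -(t * m * s) := by simp
        _ ≤ _ := Finset.sum_le_sum fun j _ => hj j
    have hPq : ‖J Pv‖ ^ 2 ≤ q ^ 2 := by gcongr; simp [hq, hm0]
    have h := norm_add_sq (𝕜 := ℂ) (J (X v)) (J (∑ j, M j (L j v)))
    rw [← map_add, ← hP] at h
    have h0 := sq_nonneg ‖J (∑ j, M j (L j v))‖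
    simp only [RCLike.re_to_complex] at h
    linarith
  rw [← htsq]
  exact sq_mul_cube_le_of_bounds (by positivity) ht0 hm0 hmq (norm_nonneg _) hs0 hsq h₁ h₂

end Subelliptic

/-- Fractional form of a bound between cubes. -/
lemma rpow_mul_sq_le_of_cube_bound {T K m p : ℝ} (hT : 0 ≤ T) (hK : 0 ≤ K) (hm : 0 ≤ m)
    (hp : 0 ≤ p) (h : T * m ^ 3 ≤ K * (p + m) ^ 3) :
    (1 + 2 * T) ^ (2 / 3 : ℝ) * m ^ 2 ≤ 2 * (1 + 2 * K) ^ (2 / 3 : ℝ) * (p ^ 2 + m ^ 2) := by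
  have hcube : ∀ x : ℝ, 0 ≤ x → (x ^ 3) ^ (2 / 3 : ℝ) = x ^ 2 := fun x hx => by
    rw [← Real.rpow_natCast, ← Real.rpow_mul hx]
    norm_num
  -- With $T=|e|^2/4+4\pi^2|\xi|^2$, the factor 2 makes $1+2T$ dominate the symbol
  -- $1+|e|^2/2+4\pi^2|\xi|^2$ of $\tilde\Lambda_{x_0}^2$.
  have h1 : (1 + 2 * T) * m ^ 3 ≤ (1 + 2 * K) * (p + m) ^ 3 := by
    have : m ^ 3 ≤ (p + m) ^ 3 := by gcongr; linarith
    linarith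
  have h2 := Real.rpow_le_rpow (by positivity) h1 (by norm_num : (0 : ℝ) ≤ 2 / 3)
  rw [Real.mul_rpow (by positivity) (by positivity), Real.mul_rpow (by positivity) (by positivity),
    hcube m hm, hcube (p + m) (by positivity)] at h2
  refine h2.trans ?_
  calc (1 + 2 * K) ^ (2 / 3 : ℝ) * (p + m) ^ 2
      ≤ (1 + 2 * K) ^ (2 / 3 : ℝ) * (2 * (p ^ 2 + m ^ 2)) := by
        gcongr
        nlinarith [sq_nonneg (p - m)]
    _ = _ := by ring

variable {n : ℕ}

/-! ### Operators on test functions and their commutators -/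

/-- The space `C₀^∞(ℝ²ⁿ)` of smooth compactly supported functions. -/
def testFunctions (n : ℕ) : Submodule ℂ (Space n × Space n → ℂ) where
  carrier := {u | ContDiff ℝ ∞ u ∧ HasCompactSupport u}
  add_mem' hu hv := ⟨hu.1.add hv.1, hu.2.add hv.2⟩
  zero_mem' := ⟨contDiff_const, HasCompactSupport.zero⟩
  smul_mem' c _ hu := ⟨contDiff_const.smul hu.1, hu.2.smul_left (f := fun _ => c)⟩

lemma differentiableAt_coe (u : testFunctions n) (p : Space n × Space n) :
    DifferentiableAt ℝ (u : Space n × Space n → ℂ) p :=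
  u.2.1.differentiable (by simp) p

lemma contDiff_fderiv_apply_const {u : Space n × Space n → ℂ} (hu : ContDiff ℝ ∞ u)
    (w : Space n × Space n) : ContDiff ℝ ∞ fun p => fderiv ℝ u p w :=
  (hu.fderiv_right (m := ∞) (by simp)).clm_apply contDiff_const

lemma hasCompactSupport_fderiv_apply_const {u : Space n × Space n → ℂ}
    (hu : HasCompactSupport u) (w : Space n × Space n) :
    HasCompactSupport fun p => fderiv ℝ u p w :=
  (hu.fderiv (𝕜 := ℝ)).comp_left
    (g := fun T : Space n × Space n →L[ℝ] ℂ => T w) (by simp)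

/-- The derivative in a fixed direction. -/
def dirDeriv (w : Space n × Space n) : testFunctions n →ₗ[ℂ] testFunctions n where
  toFun u := ⟨fun p => fderiv ℝ u.1 p w, contDiff_fderiv_apply_const u.2.1 w,
    hasCompactSupport_fderiv_apply_const u.2.2 w⟩
  map_add' u v := by
    ext p
    simp [fderiv_add (differentiableAt_coe u p) (differentiableAt_coe v p)]
  map_smul' c u := by
    ext p
    simp [fderiv_const_smul (differentiableAt_coe u p) c]

lemma contDiff_snd_coord (j : Fin n) :
    ContDiff ℝ ∞ fun p : Space n × Space n => ((p.2 j : ℝ) : ℂ) :=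
  Complex.ofRealCLM.contDiff.comp
    ((EuclideanSpace.proj j : Space n →L[ℝ] ℝ).contDiff.comp contDiff_snd)

/-- Multiplication by the coordinate `y_j`. -/
def mulY (j : Fin n) : testFunctions n →ₗ[ℂ] testFunctions n where
  toFun u := ⟨fun p => ((p.2 j : ℝ) : ℂ) * u.1 p, (contDiff_snd_coord j).mul u.2.1,
    u.2.2.mul_left⟩
  map_add' u v := by
    ext p
    simp [mul_add]
  map_smul' c u := by
    ext p
    simp [mul_left_comm]

@[simp] lemma dirDeriv_apply (w : Space n × Space n) (u : testFunctions n)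
    (p : Space n × Space n) : (dirDeriv w u).1 p = fderiv ℝ u.1 p w := rfl

@[simp] lemma mulY_apply (j : Fin n) (u : testFunctions n) (p : Space n × Space n) :
    (mulY j u).1 p = ((p.2 j : ℝ) : ℂ) * u.1 p := rfl

lemma dirDeriv_comm (w w' : Space n × Space n) (u : testFunctions n) :
    dirDeriv w (dirDeriv w' u) = dirDeriv w' (dirDeriv w u) := by
  ext p
  have hd : DifferentiableAt ℝ (fderiv ℝ u.1) p :=
    (u.2.1.fderiv_right (m := ∞) (by simp)).differentiable (by simp) p
  have key : ∀ a b : Space n × Space n,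
      fderiv ℝ (fun p => fderiv ℝ u.1 p a) p b = fderiv ℝ (fderiv ℝ u.1) p b a := fun a b => by
    rw [fderiv_clm_apply hd (differentiableAt_const a)]
    simp
  change fderiv ℝ (fun p => fderiv ℝ u.1 p w') p w = fderiv ℝ (fun p => fderiv ℝ u.1 p w) p w'
  rw [key, key]
  exact (u.2.1.contDiffAt.isSymmSndFDerivAt (by simpa using ENat.LEInfty.out)).eq w w'

lemma dirDeriv_mulY (w : Space n × Space n) (j : Fin n) (u : testFunctions n) :
    dirDeriv w (mulY j u) = mulY j (dirDeriv w u) + ((w.2 j : ℝ) : ℂ) • u := by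
  ext p
  have h1 : HasFDerivAt (fun p : Space n × Space n => ((p.2 j : ℝ) : ℂ))
      (Complex.ofRealCLM ∘L (EuclideanSpace.proj j : Space n →L[ℝ] ℝ) ∘L
        ContinuousLinearMap.snd ℝ (Space n) (Space n)) p :=
    (Complex.ofRealCLM ∘L (EuclideanSpace.proj j : Space n →L[ℝ] ℝ) ∘L
        ContinuousLinearMap.snd ℝ (Space n) (Space n)).hasFDerivAt
  have h2 : HasFDerivAt (fun p : Space n × Space n => ((p.2 j : ℝ) : ℂ) * u.1 p) _ p :=
    h1.mul (differentiableAt_coe u p).hasFDerivAt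
  change fderiv ℝ (fun p : Space n × Space n => ((p.2 j : ℝ) : ℂ) * u.1 p) p w = _
  rw [h2.fderiv]
  simp [mul_comm]

lemma mulY_comm (j k : Fin n) (u : testFunctions n) : mulY j (mulY k u) = mulY k (mulY j u) := by
  ext p
  simp [mul_left_comm]

/-- The coordinate direction `∂_{x_j}`. -/
abbrev dirX (j : Fin n) : Space n × Space n := (EuclideanSpace.single j 1, 0)

/-- The coordinate direction `∂_{y_j}`. -/
abbrev dirY (j : Fin n) : Space n × Space n := (0, EuclideanSpace.single j 1)

/-- `L_j` on test functions. -/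
def annihilationOp (j : Fin n) : testFunctions n →ₗ[ℂ] testFunctions n :=
  dirDeriv (dirY j) + (2⁻¹ : ℂ) • mulY j

/-- `L_j^*` on test functions. -/
def creationOp (j : Fin n) : testFunctions n →ₗ[ℂ] testFunctions n :=
  -dirDeriv (dirY j) + (2⁻¹ : ℂ) • mulY j

/-- The transport field `y · ∂ₓ - e · ∂_y` on test functions. -/
def transportOp (e : Space n) : testFunctions n →ₗ[ℂ] testFunctions n :=
  (∑ j, mulY j ∘ₗ dirDeriv (dirX j)) - dirDeriv (0, e)

lemma creationOp_annihilationOp (j : Fin n) (u : testFunctions n) :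
    creationOp j (annihilationOp j u) =
      -dirDeriv (dirY j) (dirDeriv (dirY j) u) + (4⁻¹ : ℂ) • mulY j (mulY j u)
        - (2⁻¹ : ℂ) • u := by
  simp only [creationOp, annihilationOp, LinearMap.add_apply, LinearMap.neg_apply,
    LinearMap.smul_apply, map_add, map_smul, dirDeriv_mulY]
  simp
  module

lemma annihilationOp_creationOp_sub (j : Fin n) (u : testFunctions n) :
    annihilationOp j (creationOp j u) - creationOp j (annihilationOp j u) = u := by
  simp only [creationOp, annihilationOp, LinearMap.add_apply, LinearMap.neg_apply,
    LinearMap.smul_apply, map_add, map_neg, map_smul, dirDeriv_mulY]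
  simp
  module

/-- Only two pairs fail to commute: $[\partial_{y_j},y\cdot\partial_x]=\partial_{x_j}$ and
$[y_j/2,-e\cdot\partial_y]=e_j/2$. Thus one commutator recovers both the missing $x$-derivative and
the force. -/
lemma annihilationOp_transportOp_sub (e : Space n) (j : Fin n) (u : testFunctions n) :
    annihilationOp j (transportOp e u) - transportOp e (annihilationOp j u) =
      dirDeriv (dirX j) u + ((e j / 2 : ℝ) : ℂ) • u := by
  have h1 : ∀ k, dirDeriv (dirY j) (mulY k (dirDeriv (dirX k) u)) =
      mulY k (dirDeriv (dirX k) (dirDeriv (dirY j) u)) +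
        if k = j then dirDeriv (dirX k) u else 0 := by
    intro k
    rw [dirDeriv_mulY, dirDeriv_comm]
    congr 1
    split_ifs with h <;> simp [h]
  have h2 : ∀ k, mulY k (dirDeriv (dirX k) (mulY j u)) =
      mulY j (mulY k (dirDeriv (dirX k) u)) := by
    intro k
    rw [dirDeriv_mulY, mulY_comm]
    simp
  simp only [transportOp, annihilationOp, LinearMap.add_apply, LinearMap.sub_apply,
    LinearMap.smul_apply, map_add, map_sub, map_smul, LinearMap.sum_apply, LinearMap.comp_apply,
    map_sum, h1, h2, Finset.sum_add_distrib, Finset.sum_ite_eq', Finset.mem_univ, if_true]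
  rw [dirDeriv_mulY, dirDeriv_comm (dirY j), ← Finset.smul_sum]
  push_cast
  module

lemma transportOp_coe (V : Space n → ℝ) (x₀ : Space n) (u : testFunctions n) :
    (transportOp (gradient V x₀) u).1 = frozenTransport V x₀ u.1 := by
  ext p
  have h : ((p.2, 0) : Space n × Space n) = ∑ j, p.2 j • dirX j := by
    refine Prod.ext ?_ ?_
    · ext i
      simp [Prod.fst_sum, Finset.sum_apply, Pi.single_apply]
    · simp [Prod.snd_sum]
  simp only [frozenTransport, h, map_sum, map_smul]
  simp [transportOp]

lemma annihilationOp_coe (j : Fin n) (u : testFunctions n) :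
    (annihilationOp j u).1 = annihilation j u.1 := by
  ext p
  simp [annihilationOp, annihilation, partialY]
  ring

lemma creationOp_coe (j : Fin n) (u : testFunctions n) :
    (creationOp j u).1 = creation j u.1 := by
  ext p
  simp [creationOp, creation, partialY]
  ring

lemma laplacian_snd_eq_sum (u : testFunctions n) (p : Space n × Space n) :
    Laplacian.laplacian (fun y => u.1 (p.1, y)) p.2 =
      ∑ j, (dirDeriv (dirY j) (dirDeriv (dirY j) u)).1 p := by
  have hf : ∀ (w : testFunctions n) (y v : Space n),
      fderiv ℝ (fun y => w.1 (p.1, y)) y v = fderiv ℝ w.1 (p.1, y) (0, v) := by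
    intro w y v
    have h : HasFDerivAt (fun y => w.1 (p.1, y)) _ y :=
      (differentiableAt_coe w (p.1, y)).hasFDerivAt.comp y (hasFDerivAt_prodMk_right p.1 y)
    rw [h.fderiv]
    simp
  have hs : ContDiff ℝ ∞ fun y => u.1 (p.1, y) := u.2.1.comp (contDiff_prodMk_right p.1)
  rw [InnerProductSpace.laplacian_eq_iteratedFDeriv_orthonormalBasis _
    (EuclideanSpace.basisFun (Fin n) ℝ)]
  refine Finset.sum_congr rfl fun j _ => ?_
  rw [iteratedFDeriv_two_apply]
  simp only [EuclideanSpace.basisFun_apply, Matrix.cons_val_zero, Matrix.cons_val_one]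
  have hd : DifferentiableAt ℝ (fderiv ℝ fun y => u.1 (p.1, y)) p.2 :=
    (hs.fderiv_right (m := ∞) (by simp)).differentiable (by simp) p.2
  have h2 := fderiv_clm_apply hd (differentiableAt_const (EuclideanSpace.single j (1 : ℝ)))
  have h3 : (fun y => fderiv ℝ (fun y => u.1 (p.1, y)) y (EuclideanSpace.single j (1 : ℝ))) =
      fun y => (dirDeriv (dirY j) u).1 (p.1, y) := by
    ext y
    rw [hf]
    rfl
  rw [h3] at h2
  have h4 := congrArg (fun T => T (EuclideanSpace.single j (1 : ℝ))) h2
  simp only [hf] at h4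
  simpa using h4.symm

/-- The two expressions of the frozen operator agree on test functions. -/
theorem frozenOp_eq_transport_add_sum (V : Space n → ℝ) (x₀ : Space n) (u : testFunctions n)
    (p : Space n × Space n) :
    frozenOp V x₀ u.1 p =
      frozenTransport V x₀ u.1 p + ∑ j, creation j (annihilation j u.1) p := by
  have h : ∀ j, creation j (annihilation j u.1) p =
      -(dirDeriv (dirY j) (dirDeriv (dirY j) u)).1 p + 4⁻¹ * ((p.2 j : ℝ) : ℂ) ^ 2 * u.1 p
        - 2⁻¹ * u.1 p := by
    intro j
    rw [← annihilationOp_coe, ← creationOp_coe, creationOp_annihilationOp]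
    simp
    ring
  simp only [h, frozenOp, laplacian_snd_eq_sum, Finset.sum_sub_distrib, Finset.sum_add_distrib,
    Finset.sum_neg_distrib, ← Finset.sum_mul, ← Finset.mul_sum, EuclideanSpace.norm_sq_eq,
    Finset.sum_const, Finset.card_univ, Fintype.card_fin, nsmul_eq_mul, Real.norm_eq_abs, sq_abs]
  push_cast
  ring

lemma frozenOp_coe (V : Space n → ℝ) (x₀ : Space n) (u : testFunctions n) :
    frozenOp V x₀ u.1 =
      (transportOp (gradient V x₀) u + ∑ j, creationOp j (annihilationOp j u)).1 := by
  ext p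
  rw [frozenOp_eq_transport_add_sum, Submodule.coe_add, Pi.add_apply, transportOp_coe,
    Submodule.coe_sum, Finset.sum_apply]
  simp only [creationOp_coe, annihilationOp_coe]

/-! ### Partial Fourier transform in $x$ and the estimate at fixed frequency -/

section Fiber

/-- The partial Fourier transform in `x`, at the frequency `ξ`. -/
def partialFourier (u : Space n × Space n → ℂ) (ξ y : Space n) : ℂ :=
  𝓕 (fun x : Space n => u (x, y)) ξ

lemma eq_zero_of_fst_notMem {u : Space n × Space n → ℂ} {x : Space n}
    (hx : x ∉ Prod.fst '' tsupport u) (y : Space n) : u (x, y) = 0 :=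
  image_eq_zero_of_notMem_tsupport fun h => hx ⟨_, h, rfl⟩

lemma eq_zero_of_snd_notMem {u : Space n × Space n → ℂ} {y : Space n}
    (hy : y ∉ Prod.snd '' tsupport u) (x : Space n) : u (x, y) = 0 :=
  image_eq_zero_of_notMem_tsupport fun h => hy ⟨_, h, rfl⟩

lemma isCompact_fst_tsupport (u : testFunctions n) : IsCompact (Prod.fst '' tsupport u.1) :=
  u.2.2.isCompact.image continuous_fst

lemma hasCompactSupport_slice (u : testFunctions n) (y : Space n) :
    HasCompactSupport fun x => u.1 (x, y) :=
  HasCompactSupport.intro (isCompact_fst_tsupport u) fun _ hx => eq_zero_of_fst_notMem hx y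

lemma contDiff_slice (u : testFunctions n) (y : Space n) : ContDiff ℝ ∞ fun x => u.1 (x, y) :=
  u.2.1.comp (contDiff_prodMk_left y)

/-- The slice `u(·, y)` as a Schwartz function. -/
def slice (u : testFunctions n) (y : Space n) : 𝓢(Space n, ℂ) :=
  (hasCompactSupport_slice u y).toSchwartzMap (contDiff_slice u y)

@[simp] lemma slice_apply (u : testFunctions n) (x y : Space n) : slice u y x = u.1 (x, y) := rfl

lemma partialFourier_eq_fourier_slice (u : testFunctions n) (ξ y : Space n) :
    partialFourier u.1 ξ y = 𝓕 (slice u y) ξ := rfl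

lemma partialFourier_eq_integral (u : Space n × Space n → ℂ) (ξ y : Space n) :
    partialFourier u ξ y = ∫ x, Real.fourierChar (-inner ℝ x ξ) • u (x, y) :=
  Real.fourier_eq _ _

lemma partialFourier_add (u v : testFunctions n) (ξ y : Space n) :
    partialFourier (u + v).1 ξ y = partialFourier u.1 ξ y + partialFourier v.1 ξ y := by
  have h : slice (u + v) y = slice u y + slice v y := rfl
  rw [partialFourier_eq_fourier_slice, h, FourierTransform.fourier_add]
  rfl

lemma partialFourier_smul (c : ℂ) (u : testFunctions n) (ξ y : Space n) :
    partialFourier (c • u).1 ξ y = c * partialFourier u.1 ξ y := by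
  have h : slice (c • u) y = c • slice u y := rfl
  rw [partialFourier_eq_fourier_slice, h, FourierTransform.fourier_smul]
  rfl

/-- At fixed $y$ the coordinate $y_j$ is a scalar, so linearity applies. -/
lemma partialFourier_mulY (j : Fin n) (u : testFunctions n) (ξ y : Space n) :
    partialFourier (mulY j u).1 ξ y = ((y j : ℝ) : ℂ) * partialFourier u.1 ξ y :=
  partialFourier_smul ((y j : ℝ) : ℂ) u ξ y

lemma partialFourier_dirX (j : Fin n) (u : testFunctions n) (ξ y : Space n) :
    partialFourier (dirDeriv (dirX j) u).1 ξ y =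
      (2 * Real.pi * Complex.I * ξ j) * partialFourier u.1 ξ y := by
  have h : slice (dirDeriv (dirX j) u) y =
      ∂_{(EuclideanSpace.single j 1 : Space n)} (slice u y) := by
    ext x
    rw [SchwartzMap.lineDerivOp_apply_eq_fderiv]
    have h : HasFDerivAt (fun x => u.1 (x, y)) _ x :=
      (differentiableAt_coe u (x, y)).hasFDerivAt.comp x (hasFDerivAt_prodMk_left x y)
    change _ = fderiv ℝ (fun x => u.1 (x, y)) x _
    rw [h.fderiv]
    simp
  rw [partialFourier_eq_fourier_slice, h, SchwartzMap.fourier_lineDerivOp_eq,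
    smul_apply, SchwartzMap.smulLeftCLM_apply_apply (by fun_prop),
    partialFourier_eq_fourier_slice]
  simp [EuclideanSpace.inner_single_right, mul_assoc]

/-- The integral runs over one compact set of $x$, whatever $\xi$ and $y$. Joint continuity gives
the measurability needed for exchanging the $\xi$ and $y$ integrals. -/
lemma continuous_partialFourier (u : testFunctions n) :
    Continuous (Function.uncurry (partialFourier u.1)) := by
  have h : ∀ p : Space n × Space n, partialFourier u.1 p.1 p.2 =
      ∫ x in Prod.fst '' tsupport u.1, Real.fourierChar (-inner ℝ x p.1) • u.1 (x, p.2) := by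
    intro p
    rw [partialFourier_eq_integral, setIntegral_eq_integral_of_forall_compl_eq_zero]
    intro x hx
    rw [eq_zero_of_fst_notMem hx, smul_zero]
  simp_rw [Function.uncurry_def, h]
  refine continuous_parametric_integral_of_continuous ?_ (isCompact_fst_tsupport u)
  have hu := u.2.1.continuous
  simp only [Function.uncurry_def]
  have h1 : Continuous fun q : (Space n × Space n) × Space n => -inner ℝ q.2 q.1.1 := by fun_prop
  have h2 : Continuous fun q : (Space n × Space n) × Space n => (q.2, q.1.2) := by fun_prop
  exact (Real.continuous_fourierChar.comp h1).smul (hu.comp h2)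

lemma continuous_partialFourier_right (u : testFunctions n) (ξ : Space n) :
    Continuous (partialFourier u.1 ξ) :=
  (continuous_partialFourier u).uncurry_left ξ

lemma hasCompactSupport_partialFourier (u : testFunctions n) (ξ : Space n) :
    HasCompactSupport (partialFourier u.1 ξ) := by
  refine HasCompactSupport.intro (u.2.2.isCompact.image continuous_snd) fun y hy => ?_
  rw [partialFourier_eq_integral]
  simp [eq_zero_of_snd_notMem hy]

lemma memLp_partialFourier (u : testFunctions n) (ξ : Space n) :
    MemLp (partialFourier u.1 ξ) 2 (volume : Measure (Space n)) :=
  (continuous_partialFourier_right u ξ).memLp_of_hasCompactSupport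
    (hasCompactSupport_partialFourier u ξ)

/-- The partial Fourier transform at `ξ`, with values in `L²(ℝⁿ_y)`. -/
def fiberMap (ξ : Space n) : testFunctions n →ₗ[ℂ] Lp ℂ 2 (volume : Measure (Space n)) where
  toFun u := (memLp_partialFourier u ξ).toLp
  map_add' u v := by
    rw [← MemLp.toLp_add]
    congr 1
    ext y
    exact partialFourier_add u v ξ y
  map_smul' c u := by
    rw [RingHom.id_apply, ← MemLp.toLp_const_smul]
    congr 1
    ext y
    exact partialFourier_smul c u ξ y

lemma inner_fiberMap (ξ : Space n) (u w : testFunctions n) :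
    inner ℂ (fiberMap ξ u) (fiberMap ξ w) =
      ∫ y, conj (partialFourier u.1 ξ y) * partialFourier w.1 ξ y := by
  rw [L2.inner_def]
  refine integral_congr_ae ?_
  filter_upwards [(memLp_partialFourier u ξ).coeFn_toLp, (memLp_partialFourier w ξ).coeFn_toLp]
    with y hu hw
  rw [RCLike.inner_apply', ← hu, ← hw]
  rfl

lemma enorm_fiberMap_sq (ξ : Space n) (u : testFunctions n) :
    ‖fiberMap ξ u‖ₑ ^ 2 = ∫⁻ y, ‖partialFourier u.1 ξ y‖ₑ ^ 2 := by
  change ‖(memLp_partialFourier u ξ).toLp‖ₑ ^ 2 = _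
  rw [Lp.enorm_toLp, eLpNorm_eq_lintegral_rpow_enorm_toReal (by simp) (by simp),
    ← ENNReal.rpow_natCast, ← ENNReal.rpow_mul]
  simp

lemma hasLineDerivAt_partialFourier (u : testFunctions n) (ξ y v : Space n) :
    HasLineDerivAt ℝ (partialFourier u.1 ξ) (partialFourier (dirDeriv (0, v) u).1 ξ y) y v := by
  set w := dirDeriv (0, v) u with hw
  obtain ⟨C, hC⟩ := w.2.2.exists_bound_of_continuous w.2.1.continuous
  have hmeas : ∀ (f : testFunctions n) (z : Space n), Continuous fun x : Space n =>
      Real.fourierChar (-inner ℝ x ξ) • f.1 (x, z) := by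
    intro f z
    have hf := f.2.1.continuous
    have h1 : Continuous fun x : Space n => -inner ℝ x ξ := by fun_prop
    have h2 : Continuous fun x : Space n => (x, z) := by fun_prop
    exact (Real.continuous_fourierChar.comp h1).smul (hf.comp h2)
  have key := hasDerivAt_integral_of_dominated_loc_of_deriv_le (𝕜 := ℝ)
    (μ := (volume : Measure (Space n))) (x₀ := (0 : ℝ)) (s := Set.univ)
    (F := fun s x => Real.fourierChar (-inner ℝ x ξ) • u.1 (x, y + s • v))
    (F' := fun s x => Real.fourierChar (-inner ℝ x ξ) • w.1 (x, y + s • v))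
    -- The derivative is bounded by $C$ and vanishes for $x$ outside a compact set independent of
    -- $s$.
    (bound := (Prod.fst '' tsupport w.1).indicator fun _ => C) Filter.univ_mem
    (Filter.Eventually.of_forall fun s => (hmeas u _).aestronglyMeasurable)
    ((hmeas u _).integrable_of_hasCompactSupport
      ((hasCompactSupport_slice u _).smul_left (f := fun x : Space n =>
        Real.fourierChar (-inner ℝ x ξ))))
    (hmeas w _).aestronglyMeasurable
    (Filter.Eventually.of_forall fun x s _ => ?_)
    ((integrable_indicator_iff (isCompact_fst_tsupport w).measurableSet).2
      (integrableOn_const (isCompact_fst_tsupport w).measure_lt_top.ne))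
    (Filter.Eventually.of_forall fun x s _ => ?_)
  · have h := key.2
    simp only [zero_smul, add_zero, ← partialFourier_eq_integral] at h
    exact h
  · by_cases hx : x ∈ Prod.fst '' tsupport w.1
    · rw [Set.indicator_of_mem hx, Circle.norm_smul]
      exact hC _
    · rw [Set.indicator_of_notMem hx, eq_zero_of_fst_notMem hx]
      simp
  · have h1 : HasDerivAt (fun s : ℝ => ((x, y + s • v) : Space n × Space n)) (0, v) s :=
      (hasDerivAt_const s x).prodMk (by simpa using ((hasDerivAt_id s).smul_const v).const_add y)
    have h2 := (differentiableAt_coe u (x, y + s • v)).hasFDerivAt.comp_hasDerivAt s h1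
    exact h2.const_smul (Real.fourierChar (-inner ℝ x ξ))

lemma integrable_conj_mul_partialFourier (u w : testFunctions n) (ξ : Space n) :
    Integrable fun y => conj (partialFourier u.1 ξ y) * partialFourier w.1 ξ y :=
  ((Complex.continuous_conj.comp (continuous_partialFourier_right u ξ)).mul
    (continuous_partialFourier_right w ξ)).integrable_of_hasCompactSupport
      (hasCompactSupport_partialFourier w ξ).mul_left

/-- Integration by parts in `y` on a fiber. -/
lemma inner_fiberMap_dirDeriv (ξ v : Space n) (u w : testFunctions n) :
    inner ℂ (fiberMap ξ (dirDeriv (0, v) u)) (fiberMap ξ w) =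
      -inner ℂ (fiberMap ξ u) (fiberMap ξ (dirDeriv (0, v) w)) := by
  rw [inner_fiberMap, inner_fiberMap, eq_comm, neg_eq_iff_eq_neg]
  refine integral_bilinear_hasLineDerivAt_right_eq_neg_left_of_integrable
    (B := ContinuousLinearMap.mul ℝ ℂ) (v := v)
    (f := fun y => conj (partialFourier u.1 ξ y))
    (f' := fun y => conj (partialFourier (dirDeriv (0, v) u).1 ξ y))
    (integrable_conj_mul_partialFourier _ _ ξ) (integrable_conj_mul_partialFourier _ _ ξ)
    (integrable_conj_mul_partialFourier _ _ ξ)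
    (fun y _ => ?_) (fun y _ => hasLineDerivAt_partialFourier w ξ y v)
  exact HasDerivAt.star (hasLineDerivAt_partialFourier u ξ y v)

lemma inner_fiberMap_mulY (ξ : Space n) (j : Fin n) (u w : testFunctions n) :
    inner ℂ (fiberMap ξ (mulY j u)) (fiberMap ξ w) =
      inner ℂ (fiberMap ξ u) (fiberMap ξ (mulY j w)) := by
  rw [inner_fiberMap, inner_fiberMap]
  congr 1 with y
  rw [partialFourier_mulY, partialFourier_mulY, map_mul, Complex.conj_ofReal]
  ring

lemma fiberMap_dirX (ξ : Space n) (j : Fin n) (u : testFunctions n) :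
    fiberMap ξ (dirDeriv (dirX j) u) = (2 * Real.pi * Complex.I * ξ j) • fiberMap ξ u := by
  change (memLp_partialFourier _ ξ).toLp = _ • (memLp_partialFourier u ξ).toLp
  rw [← MemLp.toLp_const_smul]
  congr 1
  ext y
  exact partialFourier_dirX j u ξ y

lemma inner_fiberMap_annihilationOp (ξ : Space n) (j : Fin n) (u w : testFunctions n) :
    inner ℂ (fiberMap ξ (annihilationOp j u)) (fiberMap ξ w) =
      inner ℂ (fiberMap ξ u) (fiberMap ξ (creationOp j w)) := by
  simp only [annihilationOp, creationOp, LinearMap.add_apply, LinearMap.neg_apply,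
    LinearMap.smul_apply, map_add, map_neg, map_smul, inner_add_left, inner_add_right,
    inner_neg_right, inner_smul_left, inner_smul_right, inner_fiberMap_dirDeriv,
    inner_fiberMap_mulY]
  simp [map_ofNat]

/-- On the fiber $y_j\partial_{x_j}$ is the symmetric $y_j$ times the imaginary number $2\pi
i\xi_j$, hence skew; $e\cdot\partial_y$ is skew by integration by parts. -/
lemma inner_fiberMap_transportOp (e ξ : Space n) (u w : testFunctions n) :
    inner ℂ (fiberMap ξ (transportOp e u)) (fiberMap ξ w) =
      -inner ℂ (fiberMap ξ u) (fiberMap ξ (transportOp e w)) := by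
  have h : ∀ j, inner ℂ (fiberMap ξ (mulY j (dirDeriv (dirX j) u))) (fiberMap ξ w) =
      -inner ℂ (fiberMap ξ u) (fiberMap ξ (mulY j (dirDeriv (dirX j) w))) := by
    intro j
    -- `fiberMap_dirX` needs the $x$-derivative outermost, so $y_j$ is shifted to the other factor
    -- and back.
    rw [inner_fiberMap_mulY, fiberMap_dirX, ← inner_fiberMap_mulY, fiberMap_dirX, inner_smul_left,
      inner_smul_right, inner_fiberMap_mulY]
    simp [map_ofNat]
  simp only [transportOp, LinearMap.sub_apply, LinearMap.sum_apply, LinearMap.comp_apply, map_sub,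
    map_sum, inner_sub_left, inner_sub_right, sum_inner, inner_sum, h, inner_fiberMap_dirDeriv,
    Finset.sum_neg_distrib]
  ring

lemma fiberMap_commutator (e ξ : Space n) (j : Fin n) (u : testFunctions n) :
    fiberMap ξ (annihilationOp j (transportOp e u)) -
        fiberMap ξ (transportOp e (annihilationOp j u)) =
      (((e j / 2 : ℝ) : ℂ) + ((2 * Real.pi * ξ j : ℝ) : ℂ) * Complex.I) • fiberMap ξ u := by
  rw [← map_sub, annihilationOp_transportOp_sub, map_add, map_smul, fiberMap_dirX, ← add_smul]
  congr 1
  push_cast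
  ring

/-- The constant of the subelliptic estimate in dimension `n`. -/
def subellipticConst (n : ℕ) : ℝ :=
  2 * (1 + 2 * (18 * (n : ℝ) ^ 2 + 324 * (n : ℝ) ^ 6)) ^ (2 / 3 : ℝ)

/-- The subelliptic estimate on each fiber, uniform in the frequency `ξ` and in the force `e`. -/
theorem fiber_estimate (e ξ : Space n) (u : testFunctions n) :
    (1 + 2 * (‖e‖ ^ 2 / 4 + 4 * Real.pi ^ 2 * ‖ξ‖ ^ 2)) ^ (2 / 3 : ℝ) * ‖fiberMap ξ u‖ ^ 2 ≤
      subellipticConst n *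
        (‖fiberMap ξ (transportOp e u + ∑ j, creationOp j (annihilationOp j u))‖ ^ 2 +
          ‖fiberMap ξ u‖ ^ 2) := by
  have h := subelliptic_cube_bound (fiberMap ξ) (transportOp e) annihilationOp creationOp _
    (inner_fiberMap_annihilationOp ξ) (inner_fiberMap_transportOp e ξ) (fiberMap_commutator e ξ)
    annihilationOp_creationOp_sub u
  have hζ : ∑ j, ‖((e j / 2 : ℝ) : ℂ) + ((2 * Real.pi * ξ j : ℝ) : ℂ) * Complex.I‖ ^ 2 =
      ‖e‖ ^ 2 / 4 + 4 * Real.pi ^ 2 * ‖ξ‖ ^ 2 := by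
    simp only [EuclideanSpace.norm_sq_eq, Real.norm_eq_abs, sq_abs, Finset.sum_div, Finset.mul_sum,
      ← Finset.sum_add_distrib]
    refine Finset.sum_congr rfl fun j _ => ?_
    rw [Complex.sq_norm, Complex.normSq_add_mul_I]
    ring
  rw [hζ, Fintype.card_fin] at h
  exact rpow_mul_sq_le_of_cube_bound (by positivity) (by positivity) (norm_nonneg _)
    (norm_nonneg _) h

end Fiber

/-! ### Plancherel in $x$ and integration over the frequency -/

section Global

lemma normSq_eq_lintegral (u : Space n × Space n → ℂ) : normSq u = ∫⁻ p, ‖u p‖ₑ ^ 2 := by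
  rw [normSq, eLpNorm_eq_lintegral_rpow_enorm_toReal (by simp) (by simp), ← ENNReal.rpow_natCast,
    ← ENNReal.rpow_mul]
  simp

lemma enorm_toLp_sq_eq_lintegral (f : 𝓢(Space n, ℂ)) :
    ‖f.toLp 2‖ₑ ^ 2 = ∫⁻ x, ‖f x‖ₑ ^ 2 := by
  change ‖(f.memLp 2 volume).toLp‖ₑ ^ 2 = _
  rw [Lp.enorm_toLp, eLpNorm_eq_lintegral_rpow_enorm_toReal (by simp) (by simp),
    ← ENNReal.rpow_natCast, ← ENNReal.rpow_mul]
  simp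

/-- Plancherel's identity for Schwartz functions, in terms of lower integrals. -/
lemma lintegral_enorm_fourier_sq (f : 𝓢(Space n, ℂ)) :
    ∫⁻ ξ, ‖𝓕 f ξ‖ₑ ^ 2 = ∫⁻ x, ‖f x‖ₑ ^ 2 := by
  rw [← enorm_toLp_sq_eq_lintegral, ← enorm_toLp_sq_eq_lintegral, ← ofReal_norm,
    SchwartzMap.norm_fourier_toL2_eq, ofReal_norm]

lemma lintegral_enorm_fourierInv_sq (f : 𝓢(Space n, ℂ)) :
    ∫⁻ x, ‖𝓕⁻ f x‖ₑ ^ 2 = ∫⁻ ξ, ‖f ξ‖ₑ ^ 2 := by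
  rw [← lintegral_enorm_fourier_sq (𝓕⁻ f), FourierTransform.fourier_fourierInv_eq]

lemma measurable_enorm_partialFourier_sq (u : testFunctions n) :
    Measurable fun p : Space n × Space n => ‖partialFourier u.1 p.1 p.2‖ₑ ^ 2 :=
  ((continuous_partialFourier u).measurable.enorm).pow_const 2

lemma measurable_enorm_fiberMap_sq (u : testFunctions n) :
    Measurable fun ξ : Space n => ‖fiberMap ξ u‖ₑ ^ 2 := by
  simp_rw [enorm_fiberMap_sq]
  exact (measurable_enorm_partialFourier_sq u).lintegral_prod_right'

/-- Plancherel's identity in `x`. -/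
lemma normSq_eq_lintegral_fiberMap (u : testFunctions n) :
    normSq u.1 = ∫⁻ ξ : Space n, ‖fiberMap ξ u‖ₑ ^ 2 := by
  have hu : Measurable fun p => ‖u.1 p‖ₑ ^ 2 := u.2.1.continuous.measurable.enorm.pow_const 2
  rw [normSq_eq_lintegral, Measure.volume_eq_prod, lintegral_prod_symm' _ hu]
  have h : ∀ y : Space n, ∫⁻ x, ‖u.1 (x, y)‖ₑ ^ 2 = ∫⁻ ξ, ‖partialFourier u.1 ξ y‖ₑ ^ 2 :=
    fun y => (lintegral_enorm_fourier_sq (slice u y)).symm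
  simp_rw [h, enorm_fiberMap_sq]
  exact (lintegral_lintegral_swap (measurable_enorm_partialFourier_sq u).aemeasurable).symm

/-- Rescaling $\xi$ by $2\pi/\sqrt c$ reduces to powers of $1+|\xi|^2$. Temperate growth keeps the
symbol times a Schwartz function Schwartz, so Plancherel applies to the multiplier slice by slice.
-/
lemma hasTemperateGrowth_shifted_symbol {c : ℝ} (hc : 0 < c) (a : ℝ) :
    (fun ξ : Space n => (c + 4 * Real.pi ^ 2 * ‖ξ‖ ^ 2) ^ a).HasTemperateGrowth := by
  have h : (fun ξ : Space n => (c + 4 * Real.pi ^ 2 * ‖ξ‖ ^ 2) ^ a) =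
      fun ξ => c ^ a * (1 + ‖(2 * Real.pi / √c) • ξ‖ ^ 2) ^ a := by
    ext ξ
    rw [← Real.mul_rpow hc.le (by positivity), norm_smul, mul_pow, Real.norm_eq_abs, sq_abs,
      div_pow, Real.sq_sqrt hc.le]
    congr 1
    field_simp
    ring
  rw [h]
  have h1 : (fun ξ : Space n => (2 * Real.pi / √c) • ξ).HasTemperateGrowth :=
    ((2 * Real.pi / √c) • ContinuousLinearMap.id ℝ (Space n)).hasTemperateGrowth
  have h2 := (Function.hasTemperateGrowth_one_add_norm_sq_rpow (Space n) a).comp h1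
  exact (Function.HasTemperateGrowth.const (c ^ a)).mul h2

lemma normSq_shiftedLaplacianPow_le {c : ℝ} (hc : 0 < c) (a : ℝ) (u : testFunctions n) :
    normSq (shiftedLaplacianPow c a u.1) ≤
      ∫⁻ ξ : Space n, ENNReal.ofReal ((c + 4 * Real.pi ^ 2 * ‖ξ‖ ^ 2) ^ (2 * a)) *
        ‖fiberMap ξ u‖ₑ ^ 2 := by
  set σ : Space n → ℝ := fun ξ => (c + 4 * Real.pi ^ 2 * ‖ξ‖ ^ 2) ^ a with hσ
  have hσt : (fun ξ => ((σ ξ : ℝ) : ℂ)).HasTemperateGrowth :=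
    Function.Complex.hasTemperateGrowth_ofReal.comp (hasTemperateGrowth_shifted_symbol hc a)
  have hσc : Continuous σ := (hasTemperateGrowth_shifted_symbol hc a).1.continuous
  have hσ2 : ∀ ξ, ‖((σ ξ : ℝ) : ℂ)‖ₑ ^ 2 =
      ENNReal.ofReal ((c + 4 * Real.pi ^ 2 * ‖ξ‖ ^ 2) ^ (2 * a)) := by
    intro ξ
    rw [← ofReal_norm, ← ENNReal.ofReal_pow (norm_nonneg _), Complex.norm_real, Real.norm_eq_abs,
      sq_abs, mul_comm 2 a, Real.rpow_mul (by positivity)]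
    norm_num [hσ]
  have hfib : ∀ y : Space n, ∫⁻ x, ‖shiftedLaplacianPow c a u.1 (x, y)‖ₑ ^ 2 =
      ∫⁻ ξ, ‖((σ ξ : ℝ) : ℂ)‖ₑ ^ 2 * ‖partialFourier u.1 ξ y‖ₑ ^ 2 := by
    intro y
    set g : 𝓢(Space n, ℂ) :=
      SchwartzMap.smulLeftCLM ℂ (fun ξ => ((σ ξ : ℝ) : ℂ)) (𝓕 (slice u y)) with hg
    have hgξ : ∀ ξ, g ξ = ((σ ξ : ℝ) : ℂ) * partialFourier u.1 ξ y := fun ξ => by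
      rw [hg, SchwartzMap.smulLeftCLM_apply_apply hσt]
      rfl
    have hgx : ∀ x, shiftedLaplacianPow c a u.1 (x, y) = 𝓕⁻ g x := fun x => by
      rw [SchwartzMap.fourierInv_coe, show (g : Space n → ℂ) = _ from funext hgξ]
      rfl
    simp_rw [hgx, lintegral_enorm_fourierInv_sq, hgξ, enorm_mul, mul_pow]
  rw [normSq_eq_lintegral, Measure.volume_eq_prod, ← lintegral_prod_swap]
  -- This direction of Tonelli needs no joint measurability of the multiplier's output, which is why
  -- only an inequality is claimed.
  refine (lintegral_prod_le _).trans ?_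
  simp only [Prod.swap_prod_mk, hfib]
  rw [lintegral_lintegral_swap]
  · refine lintegral_mono fun ξ => ?_
    rw [lintegral_const_mul' _ _ (by simp), enorm_fiberMap_sq, hσ2]
  · have h1 : Measurable fun p : Space n × Space n => ‖((σ p.2 : ℝ) : ℂ)‖ₑ ^ 2 :=
      ((Complex.continuous_ofReal.comp hσc).measurable.comp measurable_snd).enorm.pow_const 2
    have h2 := (measurable_enorm_partialFourier_sq u).comp (measurable_swap (α := Space n))
    exact (h1.mul h2).aemeasurable

/-- All terms to be bounded have this form: the force term for a $\sigma$ constant in $\xi$, with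
$B=2$, and the two multipliers for their squared symbols, with $B=1$. The factor $B$ times the fiber
estimate is integrated in $\xi$. -/
lemma lintegral_symbol_le (V : Space n → ℝ) (x₀ : Space n) (u : testFunctions n) {B : ℝ≥0}
    {σ : Space n → ℝ} (hσ : ∀ ξ, σ ξ ≤ B *
      (1 + 2 * (‖gradient V x₀‖ ^ 2 / 4 + 4 * Real.pi ^ 2 * ‖ξ‖ ^ 2)) ^ (2 / 3 : ℝ)) :
    ∫⁻ ξ : Space n, ENNReal.ofReal (σ ξ) * ‖fiberMap ξ u‖ₑ ^ 2 ≤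
      ((B * (subellipticConst n).toNNReal : ℝ≥0) : ℝ≥0∞) *
        (normSq (frozenOp V x₀ u.1) + normSq u.1) := by
  set Pu := transportOp (gradient V x₀) u + ∑ j, creationOp j (annihilationOp j u) with hPu
  rw [frozenOp_coe, ← hPu, normSq_eq_lintegral_fiberMap, normSq_eq_lintegral_fiberMap,
    ← lintegral_add_left (measurable_enorm_fiberMap_sq _),
    ← lintegral_const_mul' _ _ ENNReal.coe_ne_top]
  refine lintegral_mono fun ξ => ?_
  have hK : 0 ≤ subellipticConst n := by unfold subellipticConst; positivity
  have h := fiber_estimate (gradient V x₀) ξ u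
  rw [← hPu] at h
  have h' : σ ξ * ‖fiberMap ξ u‖ ^ 2 ≤
      (B * (subellipticConst n).toNNReal : ℝ≥0) * (‖fiberMap ξ Pu‖ ^ 2 + ‖fiberMap ξ u‖ ^ 2) := by
    rw [NNReal.coe_mul, Real.coe_toNNReal _ hK, mul_assoc]
    refine le_trans ?_ (mul_le_mul_of_nonneg_left h B.2)
    rw [← mul_assoc]
    exact mul_le_mul_of_nonneg_right (hσ ξ) (by positivity)
  have h'' := ENNReal.ofReal_le_ofReal h'
  rw [ENNReal.ofReal_mul' (by positivity), ENNReal.ofReal_mul (NNReal.coe_nonneg _),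
    ENNReal.ofReal_add (by positivity) (by positivity), ENNReal.ofReal_coe_nnreal,
    ENNReal.ofReal_pow (norm_nonneg _), ENNReal.ofReal_pow (norm_nonneg _), ofReal_norm,
    ofReal_norm] at h''
  exact h''

lemma rpow_four_thirds_le {s T : ℝ} (hs : 0 ≤ s) (h : s ^ 2 ≤ 2 * T) :
    s ^ (4 / 3 : ℝ) ≤ 2 * T ^ (2 / 3 : ℝ) := by
  have hT : 0 ≤ T := by nlinarith [sq_nonneg s]
  calc s ^ (4 / 3 : ℝ) = (s ^ 2) ^ (2 / 3 : ℝ) := by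
        rw [← Real.rpow_natCast, ← Real.rpow_mul hs]; norm_num
    _ ≤ (2 * T) ^ (2 / 3 : ℝ) := by gcongr
    _ = 2 ^ (2 / 3 : ℝ) * T ^ (2 / 3 : ℝ) := Real.mul_rpow (by norm_num) hT
    _ ≤ 2 * T ^ (2 / 3 : ℝ) := by
        gcongr
        exact Real.rpow_le_self_of_one_le (by norm_num) (by norm_num)

theorem gradient_add_laplacian_estimate (V : Space n → ℝ) (x₀ : Space n) (u : testFunctions n) :
    ENNReal.ofReal (‖gradient V x₀‖ ^ (4 / 3 : ℝ)) * normSq u.1 +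
        normSq (shiftedLaplacianPow 1 (1 / 3) u.1) ≤
      ((3 * (subellipticConst n).toNNReal : ℝ≥0) : ℝ≥0∞) *
        (normSq (frozenOp V x₀ u.1) + normSq u.1) := by
  have h1 : ENNReal.ofReal (‖gradient V x₀‖ ^ (4 / 3 : ℝ)) * normSq u.1 ≤
      ((2 * (subellipticConst n).toNNReal : ℝ≥0) : ℝ≥0∞) *
        (normSq (frozenOp V x₀ u.1) + normSq u.1) := by
    refine le_of_eq_of_le ?_ (lintegral_symbol_le V x₀ u
      (σ := fun _ => ‖gradient V x₀‖ ^ (4 / 3 : ℝ)) fun ξ => ?_)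
    · rw [lintegral_const_mul' _ _ ENNReal.ofReal_ne_top, normSq_eq_lintegral_fiberMap]
    · refine rpow_four_thirds_le (norm_nonneg _) ?_
      have : 0 ≤ Real.pi ^ 2 * ‖ξ‖ ^ 2 := by positivity
      linarith
  have h2 : normSq (shiftedLaplacianPow 1 (1 / 3) u.1) ≤
      ((1 * (subellipticConst n).toNNReal : ℝ≥0) : ℝ≥0∞) *
        (normSq (frozenOp V x₀ u.1) + normSq u.1) := by
    refine (normSq_shiftedLaplacianPow_le one_pos _ u).trans
      (lintegral_symbol_le V x₀ u fun ξ => ?_)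
    rw [NNReal.coe_one, one_mul, show (2 * (1 / 3) : ℝ) = 2 / 3 by norm_num]
    have : 0 ≤ Real.pi ^ 2 * ‖ξ‖ ^ 2 := by positivity
    refine Real.rpow_le_rpow (by positivity) ?_ (by norm_num)
    linarith [sq_nonneg ‖gradient V x₀‖]
  refine (add_le_add h1 h2).trans_eq ?_
  rw [← add_mul, ← ENNReal.coe_add]
  congr 2
  ring

theorem frozenLambdaPow_estimate (V : Space n → ℝ) (x₀ : Space n) (u : testFunctions n) :
    normSq (frozenLambdaPow V x₀ (2 / 3) u.1) ≤
      ((1 * (subellipticConst n).toNNReal : ℝ≥0) : ℝ≥0∞) *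
        (normSq (frozenOp V x₀ u.1) + normSq u.1) := by
  refine (normSq_shiftedLaplacianPow_le (by positivity) _ u).trans
    (lintegral_symbol_le V x₀ u fun ξ => ?_)
  rw [NNReal.coe_one, one_mul, show (2 * (2 / 3 / 2) : ℝ) = 2 / 3 by norm_num]
  have : 0 ≤ Real.pi ^ 2 * ‖ξ‖ ^ 2 := by positivity
  refine Real.rpow_le_rpow (by positivity) ?_ (by norm_num)
  linarith

end Global

end FokkerPlanck

end

theorem proposition6p1 (n : ℕ) (V : FokkerPlanck.Space n → ℝ) (hV : ContDiff ℝ 2 V) :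
    (∀ (x₀ : FokkerPlanck.Space n) (u : FokkerPlanck.Space n × FokkerPlanck.Space n → ℂ),
      ContDiff ℝ ∞ u → HasCompactSupport u →
      ∀ p, FokkerPlanck.frozenOp V x₀ u p =
        FokkerPlanck.frozenTransport V x₀ u p +
          ∑ j : Fin n, FokkerPlanck.creation j (FokkerPlanck.annihilation j u) p) ∧
    ∃ C : ℝ≥0,
      ∀ (x₀ : FokkerPlanck.Space n) (u : FokkerPlanck.Space n × FokkerPlanck.Space n → ℂ),
        ContDiff ℝ ∞ u → HasCompactSupport u →
        (ENNReal.ofReal (‖gradient V x₀‖ ^ (4 / 3 : ℝ)) * FokkerPlanck.normSq u +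
            FokkerPlanck.normSq (FokkerPlanck.shiftedLaplacianPow 1 (1 / 3) u) ≤
          C * (FokkerPlanck.normSq (FokkerPlanck.frozenOp V x₀ u) + FokkerPlanck.normSq u)) ∧
        (FokkerPlanck.normSq (FokkerPlanck.frozenLambdaPow V x₀ (2 / 3) u) ≤
          C * (FokkerPlanck.normSq (FokkerPlanck.frozenOp V x₀ u) + FokkerPlanck.normSq u)) := by
  refine ⟨fun x₀ u hu hc p => FokkerPlanck.frozenOp_eq_transport_add_sum V x₀ ⟨u, hu, hc⟩ p,
    -- Here $3=2+1$: the force term costs 2 and $(1-\Delta_x)^{1/3}$ costs 1. The estimate for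
    -- $\tilde\Lambda_{x_0}$ needs only 1.
    3 * (FokkerPlanck.subellipticConst n).toNNReal, fun x₀ u hu hc => ⟨?_, ?_⟩⟩
  · exact FokkerPlanck.gradient_add_laplacian_estimate V x₀ ⟨u, hu, hc⟩
  · refine (FokkerPlanck.frozenLambdaPow_estimate V x₀ ⟨u, hu, hc⟩).trans ?_
    gcongr
    norm_num
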